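/- Let $G$ be a compact, second countable topological group acting continuously on a compact metric space $X$, and suppose that the action is free (that is, $g\cdot x=x$ for some $x\in X$ implies $g=1$). Let $\alpha:G\to\mathrm{Aut}(C(X))$ be the induced (point-norm continuous) action on the C*-algebra $C(X)$ of continuous complex-valued functions, $\alpha_s(f)(x)=f(s^{-1}\cdot x)$. Then \[ \dim_{Rok}(\alpha)\;\le\;\dim(X/G), \] where $X/G$ is the orbit space with the quotient topology and $\dim$ is the Lebesgue covering dimension (both sides take values in $\{0,1,2,\dots,\infty\}$; in particular $\dim\emptyset=0$). Here the Rokhlin dimension $\dim_{Rok}(\alpha)$ of an action $\alpha$ of $G$ on a C*-algebra $A$ is defined as follows. Put $A_\infty=\ell^\infty(\mathbb N,A)/c_0(\mathbb N,A)$ with quotient map $\eta_A$, regard $A$ as the constant sequences in $A_\infty$, and put $F(A)=(A_\infty\cap A')/\mathrm{Ann}(A,A_\infty)$, with quotient map $\kappa_A$, where $A_\infty\cap A'$ is the relative commutant and $\mathrm{Ann}(A,A_\infty)$ the annihilator of $A$. Let $\ell^\infty_\alpha(\mathbb N,A)$ be the set of those bounded sequences $a$ for which $g\mapsto(\alpha_g(a_n))_n$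 is norm continuous, let $A_{\infty,\alpha}=\eta_A(\ell^\infty_\alpha(\mathbb N,A))$ and $F_\alpha(A)=\kappa_A(A_{\infty,\alpha}\cap A')$, and let $F(\alpha)$ be the induced action of $G$ on $F_\alpha(A)$. Let $\sigma$ be the action of $G$ on $C(G)$ given by $\sigma_s(f)(t)=f(s^{-1}t)$. Then $\dim_{Rok}(\alpha)$ is the least integer $d\ge0$ for which there exist equivariant, contractive, completely positive, order zero maps \[ \varphi_0,\dots,\varphi_d:(C(G),\sigma)\to(F_\alpha(A),F(\alpha))\quad\text{with}\quad \sum_{j=0}^d\varphi_j(1)=1_{F(A)}, \] and $\dim_{Rok}(\alpha)=\infty$ if there is no such $d$. (A map $\varphi$ has order zero if $\varphi(a)\perp\varphi(b)$ whenever $a\perp b$, where $a\perp b$ means $ab=ba=a^*b=b^*a=0$.) -/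

import Mathlib

open Filter Topology
open scoped ENNReal ComplexOrder CStarAlgebra

noncomputable section

namespace CStarRokhlin

/-- A closed two-sided (self-adjoint) ideal of a C*-algebra. -/
structure ClosedIdeal (B : Type*) [NonUnitalCStarAlgebra B] extends Submodule ℂ B where
  mul_mem_left' : ∀ (b : B) {x : B}, x ∈ carrier → b * x ∈ carrier
  mul_mem_right' : ∀ (b : B) {x : B}, x ∈ carrier → x * b ∈ carrier
  star_mem' : ∀ {x : B}, x ∈ carrier → star x ∈ carrier
  isClosed' : IsClosed carrier

/-- The quotient `B / I`, with its quotient norm. -/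
def CStarQuotient {B : Type*} [NonUnitalCStarAlgebra B] (I : ClosedIdeal B) : Type _ := B ⧸ I.toSubmodule

section Quotient

variable {B : Type*} [NonUnitalCStarAlgebra B] (I : ClosedIdeal B)

/-- The ideal `I`, as a C*-subalgebra. -/
def ClosedIdeal.toSub : NonUnitalStarSubalgebra ℂ B :=
  { I.toSubmodule with
    mul_mem' := fun {a _} _ hb => I.mul_mem_left' a hb
    star_mem' := fun h => I.star_mem' h }

instance : IsClosed (I.toSubmodule : Set B) := I.isClosed'

instance : IsClosed (I.toSub : Set B) := I.isClosed'

instance : NormedAddCommGroup (CStarQuotient I) :=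
  inferInstanceAs (NormedAddCommGroup (B ⧸ I.toSubmodule))

instance : NormedSpace ℂ (CStarQuotient I) :=
  inferInstanceAs (NormedSpace ℂ (B ⧸ I.toSubmodule))

instance : CompleteSpace (CStarQuotient I) :=
  inferInstanceAs (CompleteSpace (B ⧸ I.toSubmodule))

/-- The quotient map, as a linear map. -/
def mkL : B →ₗ[ℂ] CStarQuotient I := I.toSubmodule.mkQ

theorem mkL_surjective : Function.Surjective (mkL I) := I.toSubmodule.mkQ_surjective

theorem mkL_eq_iff {a b : B} : mkL I a = mkL I b ↔ a - b ∈ I.toSubmodule :=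
  Submodule.Quotient.eq I.toSubmodule

theorem norm_mkL_le (b : B) : ‖mkL I b‖ ≤ ‖b‖ :=
  Submodule.Quotient.norm_mk_le I.toSubmodule b

theorem exists_norm_lt (x : CStarQuotient I) {ε : ℝ} (hε : 0 < ε) : ∃ b, mkL I b = x ∧ ‖b‖ < ‖x‖ + ε :=
  Submodule.Quotient.norm_mk_lt (S := I.toSubmodule) x hε

instance : Mul (CStarQuotient I) where
  mul := Quotient.map₂ (· * ·) (by
    intro a a' ha b b' hb
    replace ha := (Submodule.quotientRel_def _).mp ha
    replace hb := (Submodule.quotientRel_def _).mp hb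
    refine (Submodule.quotientRel_def _).mpr ?_
    have : a * b - a' * b' = (a - a') * b + a' * (b - b') := by noncomm_ring
    rw [this]
    exact I.toSubmodule.add_mem (I.mul_mem_right' _ ha) (I.mul_mem_left' _ hb))

instance : Star (CStarQuotient I) where
  star := Quotient.map star (by
    intro a a' ha
    replace ha := (Submodule.quotientRel_def _).mp ha
    refine (Submodule.quotientRel_def _).mpr ?_
    rw [← star_sub]
    exact I.star_mem' ha)

theorem mkL_mul (a b : B) : mkL I (a * b) = mkL I a * mkL I b := rfl

theorem mkL_star (a : B) : mkL I (star a) = star (mkL I a) := rfl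

instance : NonUnitalRing (CStarQuotient I) where
  left_distrib x y z := by
    obtain ⟨a, rfl⟩ := mkL_surjective I x
    obtain ⟨b, rfl⟩ := mkL_surjective I y
    obtain ⟨c, rfl⟩ := mkL_surjective I z
    simp only [← map_add, ← mkL_mul, mul_add]
  right_distrib x y z := by
    obtain ⟨a, rfl⟩ := mkL_surjective I x
    obtain ⟨b, rfl⟩ := mkL_surjective I y
    obtain ⟨c, rfl⟩ := mkL_surjective I z
    simp only [← map_add, ← mkL_mul, add_mul]
  zero_mul x := by
    obtain ⟨a, rfl⟩ := mkL_surjective I x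
    rw [← map_zero (mkL I), ← mkL_mul, zero_mul]
  mul_zero x := by
    obtain ⟨a, rfl⟩ := mkL_surjective I x
    rw [← map_zero (mkL I), ← mkL_mul, mul_zero]
  mul_assoc x y z := by
    obtain ⟨a, rfl⟩ := mkL_surjective I x
    obtain ⟨b, rfl⟩ := mkL_surjective I y
    obtain ⟨c, rfl⟩ := mkL_surjective I z
    simp only [← mkL_mul, mul_assoc]

instance : StarRing (CStarQuotient I) where
  star_involutive x := by
    obtain ⟨a, rfl⟩ := mkL_surjective I x
    simp only [← mkL_star, star_star]
  star_mul x y := by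
    obtain ⟨a, rfl⟩ := mkL_surjective I x
    obtain ⟨b, rfl⟩ := mkL_surjective I y
    simp only [← mkL_mul, ← mkL_star, star_mul]
  star_add x y := by
    obtain ⟨a, rfl⟩ := mkL_surjective I x
    obtain ⟨b, rfl⟩ := mkL_surjective I y
    simp only [← map_add, ← mkL_star, star_add]

instance : IsScalarTower ℂ (CStarQuotient I) (CStarQuotient I) where
  smul_assoc c x y := by
    obtain ⟨a, rfl⟩ := mkL_surjective I x
    obtain ⟨b, rfl⟩ := mkL_surjective I y
    simp only [smul_eq_mul, ← map_smul, ← mkL_mul, smul_mul_assoc]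

instance : SMulCommClass ℂ (CStarQuotient I) (CStarQuotient I) where
  smul_comm c x y := by
    obtain ⟨a, rfl⟩ := mkL_surjective I x
    obtain ⟨b, rfl⟩ := mkL_surjective I y
    simp only [smul_eq_mul, ← map_smul, ← mkL_mul, mul_smul_comm]

instance : StarModule ℂ (CStarQuotient I) where
  star_smul c x := by
    obtain ⟨a, rfl⟩ := mkL_surjective I x
    simp only [← map_smul, ← mkL_star, star_smul]

instance : NonUnitalNormedRing (CStarQuotient I) where
  dist_eq x y := dist_eq_norm_neg_add x y
  norm_mul_le x y := by
    refine le_of_forall_pos_lt_add fun ε hε => ?_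
    have hc : Tendsto (fun δ : ℝ => (‖x‖ + δ) * (‖y‖ + δ)) (nhdsWithin 0 (Set.Ioi 0))
        (nhds (‖x‖ * ‖y‖)) := by
      have : Continuous (fun δ : ℝ => (‖x‖ + δ) * (‖y‖ + δ)) := by fun_prop
      simpa using (this.tendsto 0).mono_left nhdsWithin_le_nhds
    obtain ⟨δ, hδ, hδ0⟩ := ((hc.eventually (gt_mem_nhds (by linarith :
      ‖x‖ * ‖y‖ < ‖x‖ * ‖y‖ + ε))).and self_mem_nhdsWithin).exists
    obtain ⟨a, ha, hax⟩ := exists_norm_lt I x hδ0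
    obtain ⟨b, hb, hby⟩ := exists_norm_lt I y hδ0
    calc ‖x * y‖ = ‖mkL I (a * b)‖ := by rw [mkL_mul, ha, hb]
      _ ≤ ‖a * b‖ := norm_mkL_le I _
      _ ≤ ‖a‖ * ‖b‖ := norm_mul_le _ _
      _ ≤ (‖x‖ + δ) * (‖y‖ + δ) := by gcongr
      _ < _ := hδ

/-- Compressing by `1 - e` with `0 ≤ e ≤ 1` does not increase the norm. -/
theorem norm_compress_le (e : B)
    (hn : ‖(1 : Unitization ℂ B) - (e : Unitization ℂ B)‖ ≤ 1) (c : B) :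
    ‖c - c * e - e * c + e * c * e‖ ≤ ‖c‖ := by
  have h : ((c - c * e - e * c + e * c * e : B) : Unitization ℂ B)
      = (1 - (e : Unitization ℂ B)) * c * (1 - (e : Unitization ℂ B)) := by
    simp only [Unitization.inr_add, Unitization.inr_sub, Unitization.inr_mul]
    noncomm_ring
  rw [← Unitization.norm_inr (𝕜 := ℂ), h]
  calc _ ≤ ‖(1 : Unitization ℂ B) - (e : Unitization ℂ B)‖ * ‖(c : Unitization ℂ B)‖ *
        ‖(1 : Unitization ℂ B) - (e : Unitization ℂ B)‖ := by
        refine (norm_mul_le _ _).trans ?_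
        gcongr
        exact norm_mul_le _ _
    _ ≤ 1 * ‖(c : Unitization ℂ B)‖ * 1 := by gcongr
    _ = ‖c‖ := by rw [one_mul, mul_one, Unitization.norm_inr]

theorem norm_one_sub_le (e : I.toSub) (he : ∃ d : I.toSub, e = star d * d) (hn : ‖e‖ ≤ 1) :
    ‖(1 : Unitization ℂ B) - ((e : B) : Unitization ℂ B)‖ ≤ 1 := by
  let _ := CStarAlgebra.spectralOrder (Unitization ℂ B)
  have _ := CStarAlgebra.spectralOrderedRing (Unitization ℂ B)
  obtain ⟨d, hd⟩ := he
  have h0 : (0 : Unitization ℂ B) ≤ ((e : B) : Unitization ℂ B) := by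
    have : ((e : B) : Unitization ℂ B) =
        star ((d : B) : Unitization ℂ B) * ((d : B) : Unitization ℂ B) := by
      rw [hd]; simp [Unitization.inr_mul, Unitization.inr_star]
    rw [this]
    exact star_mul_self_nonneg _
  have h1 : ‖((e : B) : Unitization ℂ B)‖ ≤ 1 := by
    rw [Unitization.norm_inr]; exact hn
  have hm := CStarAlgebra.mem_Icc_iff_norm_le_one.mpr ⟨h0, h1⟩
  have hm' : (1 : Unitization ℂ B) - ((e : B) : Unitization ℂ B) ∈
      Set.Icc (0 : Unitization ℂ B) 1 := Set.sub_mem_Icc_zero_iff_right.mpr hm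
  exact (CStarAlgebra.mem_Icc_iff_norm_le_one.mp hm').2

instance : CStarRing (CStarQuotient I) where
  norm_mul_self_le x := by
    obtain ⟨b, rfl⟩ := mkL_surjective I x
    refine le_of_forall_pos_le_add fun ε hε => ?_
    rw [← mkL_star, ← mkL_mul]
    obtain ⟨c, hc, hcn⟩ := exists_norm_lt I (mkL I (star b * b)) (half_pos hε)
    have hi : star b * b - c ∈ I.toSubmodule := (mkL_eq_iff I).mp hc.symm
    let _ := CStarAlgebra.spectralOrder I.toSub
    have _ := CStarAlgebra.spectralOrderedRing I.toSub
    let i : I.toSub := ⟨star b * b - c, hi⟩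
    have hl := CStarAlgebra.increasingApproximateUnit (A := I.toSub)
    have ht : Tendsto (fun e : I.toSub => ‖i - i * e‖)
        (CStarAlgebra.approximateUnit I.toSub) (nhds 0) := by
      have := (tendsto_const_nhds (x := i)).sub (hl.tendsto_mul_left i)
      simpa using this.norm
    obtain ⟨e, ⟨⟨he1, he2⟩, he3⟩⟩ := (((ht.eventually (gt_mem_nhds
      (by positivity : (0 : ℝ) < ε / 4))).and hl.eventually_nonneg).and hl.eventually_norm).exists
    have hsq : ∃ d : I.toSub, e = star d * d := CStarAlgebra.nonneg_iff_eq_star_mul_self.mp he2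
    have h1 := norm_one_sub_le I e hsq he3
    have hsa : IsSelfAdjoint (e : B) := by
      have : star e = e := (IsSelfAdjoint.of_nonneg he2)
      exact congrArg Subtype.val this
    have hmk : mkL I b = mkL I (b - b * e) := by
      rw [mkL_eq_iff]
      simpa using I.mul_mem_left' b e.2
    have hE : star (b - b * (e : B)) * (b - b * e)
        = (c - c * e - e * c + e * c * e)
          + ((star b * b - c) - (star b * b - c) * e - (e * (star b * b - c)
            - e * (star b * b - c) * e)) := by
      rw [star_sub, star_mul, hsa.star_eq]
      noncomm_ring
    have hk : ‖(star b * b - c) - (star b * b - c) * e‖ < ε / 4 := he1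
    calc ‖mkL I b‖ * ‖mkL I b‖ ≤ ‖b - b * e‖ * ‖b - b * e‖ := by
          rw [hmk]; gcongr <;> exact norm_mkL_le I _
      _ = ‖star (b - b * (e : B)) * (b - b * e)‖ := (CStarRing.norm_star_mul_self).symm
      _ ≤ ‖c - c * e - e * c + e * c * e‖ + (‖(star b * b - c) - (star b * b - c) * e‖
            + ‖(e : B)‖ * ‖(star b * b - c) - (star b * b - c) * e‖) := by
          rw [hE]
          refine (norm_add_le _ _).trans (add_le_add le_rfl ((norm_sub_le _ _).trans
            (add_le_add le_rfl ?_)))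
          rw [mul_assoc, ← mul_sub]
          exact norm_mul_le _ _
      _ ≤ ‖c‖ + (ε / 4 + 1 * (ε / 4)) := by
          have h2 : ‖(e : B)‖ ≤ 1 := he3
          gcongr
          exact norm_compress_le (e : B) h1 c
      _ ≤ ‖mkL I (star b * b)‖ + ε := by linarith

instance : NonUnitalCStarAlgebra (CStarQuotient I) where

/-- The usual order of a C*-algebra: `x ≤ y` iff `y - x` is positive. -/
instance : PartialOrder (CStarQuotient I) := CStarAlgebra.spectralOrder _

instance : StarOrderedRing (CStarQuotient I) := CStarAlgebra.spectralOrderedRing _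

/-- The quotient map `B → B / I`. -/
def mk : B →⋆ₙₐ[ℂ] CStarQuotient I where
  toFun := mkL I
  map_smul' c b := map_smul (mkL I) c b
  map_zero' := map_zero (mkL I)
  map_add' a b := map_add (mkL I) a b
  map_mul' a b := mkL_mul I a b
  map_star' a := mkL_star I a

variable {B' : Type*} [NonUnitalCStarAlgebra B'] {I} {J : ClosedIdeal B'}

/-- The homomorphism `B / I → B' / J` induced by `θ : B → B'` with `θ(I) ⊆ J`. -/
def quotientMap (θ : B →⋆ₙₐ[ℂ] B') (h : ∀ x ∈ I.toSubmodule, θ x ∈ J.toSubmodule) :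
    CStarQuotient I →⋆ₙₐ[ℂ] CStarQuotient J where
  toFun := Submodule.mapQ I.toSubmodule J.toSubmodule (θ : B →ₗ[ℂ] B') h
  map_smul' c x := map_smul (Submodule.mapQ I.toSubmodule J.toSubmodule (θ : B →ₗ[ℂ] B') h) c x
  map_zero' := map_zero (Submodule.mapQ I.toSubmodule J.toSubmodule (θ : B →ₗ[ℂ] B') h)
  map_add' x y := map_add (Submodule.mapQ I.toSubmodule J.toSubmodule (θ : B →ₗ[ℂ] B') h) x y
  map_mul' x y := by
    obtain ⟨a, rfl⟩ := mkL_surjective I x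
    obtain ⟨b, rfl⟩ := mkL_surjective I y
    exact congrArg (mkL J) (map_mul θ a b)
  map_star' x := by
    obtain ⟨a, rfl⟩ := mkL_surjective I x
    exact congrArg (mkL J) (map_star θ a)

theorem quotientMap_mk (θ : B →⋆ₙₐ[ℂ] B') (h : ∀ x ∈ I.toSubmodule, θ x ∈ J.toSubmodule) (b : B) :
    quotientMap θ h (mk I b) = mk J (θ b) := rfl

end Quotient

section Sequences

variable (A : Type*) [NonUnitalCStarAlgebra A]

/-- The C*-algebra `ℓ^∞(ℕ, A)` of bounded sequences in `A`. -/
abbrev BoundedSeq : Type _ := lp (fun _ : ℕ => A) ∞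

/-- The ideal `c₀(ℕ, A)` of sequences converging to zero in norm. -/
def nullIdeal : ClosedIdeal (BoundedSeq A) where
  carrier := {a | Tendsto (fun n => a n) atTop (𝓝 0)}
  add_mem' {a b} ha hb := by simpa using Tendsto.add ha hb
  zero_mem' := by simp
  smul_mem' c a ha := by simpa using Tendsto.const_smul ha c
  mul_mem_left' b x hx := by
    rw [Set.mem_ofPred_eq, tendsto_zero_iff_norm_tendsto_zero] at hx ⊢
    refine squeeze_zero (fun n => norm_nonneg _) (fun n => ?_)
      (by simpa using hx.const_mul ‖b‖)
    exact (norm_mul_le _ _).trans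
      (mul_le_mul_of_nonneg_right (lp.norm_apply_le_norm ENNReal.top_ne_zero b n) (norm_nonneg _))
  mul_mem_right' b x hx := by
    rw [Set.mem_ofPred_eq, tendsto_zero_iff_norm_tendsto_zero] at hx ⊢
    refine squeeze_zero (fun n => norm_nonneg _) (fun n => ?_)
      (by simpa using hx.mul_const ‖b‖)
    exact (norm_mul_le _ _).trans
      (mul_le_mul_of_nonneg_left (lp.norm_apply_le_norm ENNReal.top_ne_zero b n) (norm_nonneg _))
  star_mem' {x} hx := by
    rw [Set.mem_ofPred_eq, tendsto_zero_iff_norm_tendsto_zero] at hx ⊢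
    simpa using hx
  isClosed' := by
    refine isClosed_of_closure_subset fun a ha => ?_
    refine Metric.tendsto_atTop.mpr fun ε hε => ?_
    obtain ⟨b, hb, hab⟩ := Metric.mem_closure_iff.mp ha (ε / 2) (half_pos hε)
    obtain ⟨N, hN⟩ := Metric.tendsto_atTop.mp hb (ε / 2) (half_pos hε)
    refine ⟨N, fun n hn => ?_⟩
    have h1 := hN n hn
    have h2 : ‖a n - b n‖ ≤ ‖a - b‖ := lp.norm_apply_le_norm ENNReal.top_ne_zero (a - b) n
    rw [dist_zero_right] at h1 ⊢
    rw [dist_eq_norm] at hab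
    calc ‖a n‖ = ‖(a n - b n) + b n‖ := by rw [sub_add_cancel]
      _ ≤ ‖a n - b n‖ + ‖b n‖ := norm_add_le _ _
      _ < ε := by linarith

/-- The sequence algebra `A_∞ = ℓ^∞(ℕ, A) / c₀(ℕ, A)`. -/
abbrev SeqAlgebra : Type _ := CStarQuotient (nullIdeal A)

/-- The quotient map `η_A : ℓ^∞(ℕ, A) → A_∞`. -/
abbrev eta : BoundedSeq A →⋆ₙₐ[ℂ] SeqAlgebra A := mk (nullIdeal A)

variable {A}

/-- The constant sequence with value `a`. -/
def constSeq (a : A) : BoundedSeq A :=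
  ⟨fun _ => a, memℓp_infty ⟨‖a‖, by rintro _ ⟨_, rfl⟩; exact le_rfl⟩⟩

/-- The image of `a ∈ A` in `A_∞`, as the class of a constant sequence. -/
def ofAlg (a : A) : SeqAlgebra A := eta A (constSeq a)

variable (A)

/-- The relative commutant `A_∞ ∩ A'`. -/
def relCommutant : NonUnitalStarSubalgebra ℂ (SeqAlgebra A) :=
  NonUnitalStarSubalgebra.centralizer ℂ (Set.range (ofAlg (A := A)))

variable {A}

theorem ofAlg_star (a : A) : ofAlg (star a) = star (ofAlg a) := rfl

theorem mem_relCommutant {x : SeqAlgebra A} :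
    x ∈ relCommutant A ↔ ∀ a : A, ofAlg a * x = x * ofAlg a := by
  refine NonUnitalStarSubalgebra.mem_centralizer_iff ℂ |>.trans ⟨fun h a => (h _ ⟨a, rfl⟩).1, ?_⟩
  rintro h _ ⟨a, rfl⟩
  exact ⟨h a, by rw [← ofAlg_star]; exact h _⟩

variable (A)

instance : IsClosed (relCommutant A : Set (SeqAlgebra A)) := by
  have : (relCommutant A : Set (SeqAlgebra A)) = ⋂ a : A, {x | ofAlg a * x = x * ofAlg a} := by
    ext x
    simp [mem_relCommutant]
  rw [this]
  exact isClosed_iInter fun a => isClosed_eq (by fun_prop) (by fun_prop)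

/-- The annihilator `Ann(A, A_∞)`, as an ideal of `A_∞ ∩ A'`. -/
def annIdeal : ClosedIdeal (relCommutant A) where
  carrier := {x | ∀ a : A, (x : SeqAlgebra A) * ofAlg a = 0 ∧ ofAlg a * (x : SeqAlgebra A) = 0}
  add_mem' {x y} hx hy a := by
    simp [add_mul, mul_add, (hx a).1, (hx a).2, (hy a).1, (hy a).2]
  zero_mem' a := by simp
  smul_mem' c x hx a := by
    simp [smul_mul_assoc, mul_smul_comm, (hx a).1, (hx a).2]
  mul_mem_left' b x hx a := by
    refine ⟨?_, ?_⟩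
    · simp [mul_assoc, (hx a).1]
    · have hb := mem_relCommutant.mp b.2 a
      simp only [NonUnitalStarSubalgebra.coe_mul]
      rw [← mul_assoc, hb, mul_assoc, (hx a).2, mul_zero]
  mul_mem_right' b x hx a := by
    refine ⟨?_, ?_⟩
    · have hb := mem_relCommutant.mp b.2 a
      simp only [NonUnitalStarSubalgebra.coe_mul]
      rw [mul_assoc, ← hb, ← mul_assoc, (hx a).1, zero_mul]
    · simp [← mul_assoc, (hx a).2]
  star_mem' {x} hx a := by
    refine ⟨?_, ?_⟩
    · have := congrArg star (hx (star a)).2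
      simpa [star_mul, ofAlg_star] using this
    · have := congrArg star (hx (star a)).1
      simpa [star_mul, ofAlg_star] using this
  isClosed' := by
    have : {x : relCommutant A | ∀ a : A, (x : SeqAlgebra A) * ofAlg a = 0 ∧
        ofAlg a * (x : SeqAlgebra A) = 0} = ⋂ a : A,
        ({x : relCommutant A | (x : SeqAlgebra A) * ofAlg a = 0} ∩
          {x : relCommutant A | ofAlg a * (x : SeqAlgebra A) = 0}) := by
      ext x
      simp
    change IsClosed {x : relCommutant A | ∀ a : A, (x : SeqAlgebra A) * ofAlg a = 0 ∧
        ofAlg a * (x : SeqAlgebra A) = 0}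
    rw [this]
    exact isClosed_iInter fun a => (isClosed_eq (by fun_prop) (by fun_prop)).inter
      (isClosed_eq (by fun_prop) (by fun_prop))

/-- The central sequence algebra `F(A) = (A_∞ ∩ A') / Ann(A, A_∞)`. -/
abbrev CentralSeqAlgebra : Type _ := CStarQuotient (annIdeal A)

/-- The quotient map `κ_A : A_∞ ∩ A' → F(A)`. -/
abbrev kappa : relCommutant A →⋆ₙₐ[ℂ] CentralSeqAlgebra A := mk (annIdeal A)

end Sequences

section Actions

/-- An action of a topological group `G` on a C*-algebra `A`: a homomorphism `G → Aut(A)` that is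
continuous for the point-norm topology. -/
structure CStarAction (G A : Type*) [Group G] [TopologicalSpace G] [NonUnitalCStarAlgebra A] where
  toHom : G →* (A ≃⋆ₐ[ℂ] A)
  continuous' : ∀ a : A, Continuous fun g => toHom g a

variable {G A : Type*} [Group G] [TopologicalSpace G] [NonUnitalCStarAlgebra A]

/-- The termwise action of a *-automorphism on `ℓ^∞(ℕ, A)`. -/
def seqMap (θ : A ≃⋆ₐ[ℂ] A) : BoundedSeq A →⋆ₙₐ[ℂ] BoundedSeq A where
  toFun a := ⟨fun n => θ (a n), memℓp_infty ⟨‖a‖, by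
    rintro _ ⟨n, rfl⟩
    exact (NonUnitalStarAlgHom.norm_apply_le θ (a n)).trans
      (lp.norm_apply_le_norm ENNReal.top_ne_zero a n)⟩⟩
  map_smul' c a := by ext n; exact map_smul θ c (a n)
  map_zero' := by ext n; exact map_zero θ
  map_add' a b := by ext n; exact map_add θ (a n) (b n)
  map_mul' a b := by ext n; exact map_mul θ (a n) (b n)
  map_star' a := by ext n; exact map_star θ (a n)

/-- The endomorphism of `A_∞` induced by a *-automorphism of `A`. -/
def seqAlgebraMap (θ : A ≃⋆ₐ[ℂ] A) : SeqAlgebra A →⋆ₙₐ[ℂ] SeqAlgebra A :=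
  quotientMap (seqMap θ) (fun x hx => by
    change Tendsto (fun n => θ (x n)) atTop (𝓝 0)
    replace hx : Tendsto (fun n => x n) atTop (𝓝 0) := hx
    rw [tendsto_zero_iff_norm_tendsto_zero] at hx ⊢
    exact squeeze_zero (fun n => norm_nonneg _)
      (fun n => NonUnitalStarAlgHom.norm_apply_le θ (x n)) hx)

theorem seqAlgebraMap_ofAlg (θ : A ≃⋆ₐ[ℂ] A) (a : A) :
    seqAlgebraMap θ (ofAlg a) = ofAlg (θ a) := rfl

/-- The restriction of the induced endomorphism of `A_∞` to `A_∞ ∩ A'`. -/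
def relCommutantMap (θ : A ≃⋆ₐ[ℂ] A) : relCommutant A →⋆ₙₐ[ℂ] relCommutant A :=
  NonUnitalStarAlgHom.codRestrict
    ((seqAlgebraMap θ).comp (NonUnitalStarSubalgebraClass.subtype (relCommutant A)))
    (relCommutant A) (fun x => mem_relCommutant.mpr fun a => by
      have h := congrArg (seqAlgebraMap θ) (mem_relCommutant.mp x.2 (θ.symm a))
      rw [map_mul, map_mul, seqAlgebraMap_ofAlg, StarAlgEquiv.apply_symm_apply] at h
      exact h)

/-- The endomorphism `F(θ)` of `F(A)` induced by a *-automorphism `θ` of `A`. -/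
def centralSeqMap (θ : A ≃⋆ₐ[ℂ] A) : CentralSeqAlgebra A →⋆ₙₐ[ℂ] CentralSeqAlgebra A :=
  quotientMap (relCommutantMap θ) (fun x hx a => by
    have h1 := congrArg (seqAlgebraMap θ) (hx (θ.symm a)).1
    have h2 := congrArg (seqAlgebraMap θ) (hx (θ.symm a)).2
    rw [map_mul, map_zero, seqAlgebraMap_ofAlg, StarAlgEquiv.apply_symm_apply] at h1 h2
    exact ⟨h1, h2⟩)

/-- The C*-algebra `ℓ^∞_α(ℕ, A)` of bounded sequences whose orbit map is continuous. -/
def CStarAction.contSeq (α : CStarAction G A) : NonUnitalStarSubalgebra ℂ (BoundedSeq A) where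
  carrier := {a | Continuous fun g => seqMap (α.toHom g) a}
  add_mem' {a b} ha hb := by
    simp only [Set.mem_ofPred_eq, map_add] at *
    exact ha.add hb
  zero_mem' := by simpa using continuous_const
  smul_mem' c a ha := by
    simp only [Set.mem_ofPred_eq, map_smul] at *
    exact ha.const_smul c
  mul_mem' {a b} ha hb := by
    simp only [Set.mem_ofPred_eq, map_mul] at *
    exact ha.mul hb
  star_mem' {a} ha := by
    simp only [Set.mem_ofPred_eq, map_star] at *
    exact ha.star

/-- The C*-algebra `A_{∞,α} = η_A(ℓ^∞_α(ℕ, A))`. -/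
def CStarAction.contSeqAlgebra (α : CStarAction G A) : NonUnitalStarSubalgebra ℂ (SeqAlgebra A) :=
  α.contSeq.map (eta A)

/-- The C*-algebra `F_α(A) = κ_A(A_{∞,α} ∩ A')`. -/
def CStarAction.contCentralSeqAlgebra (α : CStarAction G A) :
    NonUnitalStarSubalgebra ℂ (CentralSeqAlgebra A) :=
  (α.contSeqAlgebra.comap (NonUnitalStarSubalgebraClass.subtype (relCommutant A))).map (kappa A)

end Actions

section RokhlinDimension

/-- Orthogonality of elements of a C*-algebra. -/
def Orthogonal {B : Type*} [NonUnitalCStarAlgebra B] (a b : B) : Prop :=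
  a * b = 0 ∧ b * a = 0 ∧ star a * b = 0 ∧ star b * a = 0

variable {G A : Type*} [Group G] [TopologicalSpace G] [IsTopologicalGroup G] [CompactSpace G]
  [NonUnitalCStarAlgebra A]

/-- The left translation action on `C(G)`: `σ_s(f)(t) = f(s⁻¹ t)`. -/
def leftTranslate (s : G) (f : C(G, ℂ)) : C(G, ℂ) := ⟨fun t => f (s⁻¹ * t), by fun_prop⟩

/-- `φ` is an equivariant, contractive, completely positive, order zero map
`(C(G), σ) → (F_α(A), F(α))`.  A map into the C*-subalgebra `F_α(A)` of `F(A)` is encoded as a map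
into `F(A)` with values in `F_α(A)`; complete positivity does not depend on the choice. -/
structure IsRokhlinTower (α : CStarAction G A) (φ : C(G, ℂ) →CP CentralSeqAlgebra A) : Prop where
  mem : ∀ f, φ f ∈ α.contCentralSeqAlgebra
  equivariant : ∀ (s : G) (f : C(G, ℂ)), φ (leftTranslate s f) = centralSeqMap (α.toHom s) (φ f)
  contractive : ∀ f, ‖φ f‖ ≤ ‖f‖
  orderZero : ∀ f₁ f₂ : C(G, ℂ), Orthogonal f₁ f₂ → Orthogonal (φ f₁) (φ f₂)

/-- There are towers `φ₀, …, φ_d` with `∑ⱼ φⱼ(1)` the unit of `F(A)`. -/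
def HasRokhlinTowers (α : CStarAction G A) (d : ℕ) : Prop :=
  ∃ φ : Fin (d + 1) → (C(G, ℂ) →CP CentralSeqAlgebra A),
    (∀ j, IsRokhlinTower α (φ j)) ∧
    ∀ x : CentralSeqAlgebra A, (∑ j, φ j 1) * x = x ∧ x * (∑ j, φ j 1) = x

/-- The Rokhlin dimension `dim_Rok(α) ∈ {0, 1, 2, …, ∞}`: the least `d` for which there are such
towers `φ₀, …, φ_d`, and `∞` if there is none. -/
def rokhlinDim (α : CStarAction G A) : ℕ∞ := ⨅ (d : ℕ) (_ : HasRokhlinTowers α d), (d : ℕ∞)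

end RokhlinDimension

section Covering

/-- Every finite open cover of `Y` has a finite open refinement of order at most `n + 1`, that is,
such that no point lies in more than `n + 1` of its members. -/
def CoveringDimLE (Y : Type*) [TopologicalSpace Y] (n : ℕ) : Prop :=
  ∀ (k : ℕ) (U : Fin k → Set Y), (∀ i, IsOpen (U i)) → (⋃ i, U i) = Set.univ →
    ∃ (m : ℕ) (V : Fin m → Set Y), (∀ j, IsOpen (V j)) ∧ (⋃ j, V j) = Set.univ ∧
      (∀ j, ∃ i, V j ⊆ U i) ∧ ∀ y : Y, {j | y ∈ V j}.ncard ≤ n + 1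

/-- The Lebesgue covering dimension, with values in `{0, 1, 2, …, ∞}`. -/
def coveringDim (Y : Type*) [TopologicalSpace Y] : ℕ∞ :=
  ⨅ (n : ℕ) (_ : CoveringDimLE Y n), (n : ℕ∞)

end Covering

section Induced

variable (G X : Type*) [Group G] [TopologicalSpace G] [IsTopologicalGroup G] [TopologicalSpace X]
  [CompactSpace X] [MulAction G X] [ContinuousSMul G X]

/-- The *-automorphism `α_s` of `C(X)`, `α_s(f)(x) = f(s⁻¹ • x)`. -/
def translateEquiv (s : G) : C(X, ℂ) ≃⋆ₐ[ℂ] C(X, ℂ) where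
  toFun f := ⟨fun x => f (s⁻¹ • x), by fun_prop⟩
  invFun f := ⟨fun x => f (s • x), by fun_prop⟩
  left_inv f := by ext x; simp
  right_inv f := by ext x; simp
  map_mul' f g := rfl
  map_add' f g := rfl
  map_star' f := rfl
  map_smul' c f := rfl

/-- The action of `G` on `C(X)` induced by a continuous action of `G` on the compact space `X`. -/
def inducedAction : CStarAction G C(X, ℂ) where
  toHom :=
    { toFun := translateEquiv G X
      map_one' := by ext f x; simp [translateEquiv]
      map_mul' := fun s t => by
        ext f x
        simp [translateEquiv, mul_smul] }
  continuous' f := by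
    let F : C(G, C(X, ℂ)) :=
      ContinuousMap.curry ⟨fun p : G × X => f (p.1⁻¹ • p.2), by fun_prop⟩
    exact F.continuous

end Induced

end CStarRokhlin

end

/-! A free action of a compact group need not have local cross-sections, but every point has an open
neighbourhood `B` whose return times `{s | s • B ∩ B ≠ ∅}` lie in a prescribed neighbourhood `W` of
`1`. The images of such sets cover the compact Hausdorff space `X/G`. Ostrand's decomposition
refines this cover to `d + 1` colours of pairwise disjoint sets, so that each colour yields one open
`O j ⊆ X` with return times in `W`, and the saturations of the `O j` cover `X`
(`exists_open_slices`).

Nonnegative functions `K j` positive exactly on `O j` can be normalised so that their Haar averages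
along orbits sum to `1`. The maps `ψ j f x = ∫ f(g) K j (g⁻¹ x) dg` are then exactly equivariant and
satisfy `∑ ψ j 1 = 1`. At each `x` they integrate `f` against a positive measure of mass `m ≤ 1`
carried by a translate `g₀ W`, so `ψ j f x` is `f(g₀) m` up to `m` times the oscillation of `f` at
scale `W` (`IsLocalized`).

Letting `W` shrink along a countable basis at `1` makes the errors vanish in `F(C(X))`. Order zero
holds because `f₁ f₂ = 0` forces `f₁(g₀) = 0` or `f₂(g₀) = 0` (`IsLocalized.norm_mul_le`). Complete
positivity follows from the factorisation `φ(f₁* f₂) = θ(f₁)* θ(f₂)`, with `θ` the class of `ψ f /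
√(ψ 1 + δ)`, `δ → 0` (`IsLocalized.norm_star_mul_sub_le`). Centrality is automatic since `C(X)` is
commutative. -/

namespace CStarRokhlin

/-! ### Colouring a cover of bounded order -/

/-- Ostrand's decomposition: in a normal space of covering dimension at most `n`, every finite
open cover has an open refinement made of `n + 1` finite families of pairwise disjoint sets. -/
theorem CoveringDimLE.exists_disjoint_families {Y : Type*} [TopologicalSpace Y] [NormalSpace Y]
    {n : ℕ} (h : CoveringDimLE Y n) {k : ℕ} (U : Fin k → Set Y) (hU : ∀ i, IsOpen (U i))
    (hcov : (⋃ i, U i) = Set.univ) :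
    ∃ (m : ℕ) (W : Fin (n + 1) → Finset (Fin m) → Set Y), (∀ j S, IsOpen (W j S)) ∧
      (∀ j S, (W j S).Nonempty → ∃ i, W j S ⊆ U i) ∧
      (∀ j S T y, y ∈ W j S → y ∈ W j T → S = T) ∧ ∀ y, ∃ j S, y ∈ W j S := by
  obtain ⟨m, V, hVo, hVc, hVU, hVn⟩ := h k U hU hcov
  obtain ⟨p, hp⟩ := PartitionOfUnity.exists_isSubordinate_of_locallyFinite isClosed_univ V hVo
    (locallyFinite_of_finite V) hVc.ge
  have hpV : ∀ i y, 0 < p i y → y ∈ V i := fun i y hy =>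
    hp i (subset_tsupport _ (Function.mem_support.mpr hy.ne'))
  -- Points where the functions indexed by `S` are positive and strictly dominate all the others.
  -- The colour is `S.card - 1`, which excludes the empty `S`.
  refine ⟨m, fun j S => {y | S.card = j + 1 ∧ ∀ i ∈ S, 0 < p i y ∧ ∀ l ∉ S, p l y < p i y},
    fun j S => ?_, ?_, ?_, fun y => ?_⟩
  · simp only [Set.ofPred_and, Set.ofPred_forall]
    refine isOpen_const.inter (isOpen_iInter_of_finite fun i => isOpen_iInter_of_finite fun _ => ?_)
    refine (isOpen_lt continuous_const (p i).continuous).inter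
      (isOpen_iInter_of_finite fun l => isOpen_iInter_of_finite fun _ =>
        isOpen_lt (p l).continuous (p i).continuous)
  · rintro j S ⟨y, hy⟩
    obtain ⟨i, hi⟩ : S.Nonempty := Finset.card_pos.mp (by have := hy.1; omega)
    obtain ⟨i', hi'⟩ := hVU i
    exact ⟨i', fun z hz => hi' (hpV i z (hz.2 i hi).1)⟩
  -- Distinct sets of equal size each contain an index missing from the other, and each of these two
  -- functions would dominate the other at `y`.
  · rintro j S T y ⟨hS, hS'⟩ ⟨hT, hT'⟩
    by_contra hne
    obtain ⟨a, haS, haT⟩ : ∃ a ∈ S, a ∉ T := by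
      by_contra! hc
      exact hne (Finset.eq_of_subset_of_card_le hc (by omega))
    obtain ⟨b, hbT, hbS⟩ : ∃ b ∈ T, b ∉ S := by
      by_contra! hc
      exact hne (Finset.eq_of_subset_of_card_le hc (by omega)).symm
    exact lt_asymm ((hS' a haS).2 b hbS) ((hT' b hbT).2 a haT)
  · classical
    -- For the full set of indices positive at `y`, domination is automatic; the order of the cover
    -- bounds its size by `n + 1`.
    let S : Finset (Fin m) := {i | 0 < p i y}
    have hS1 : S.Nonempty := by
      obtain ⟨i, hi⟩ := p.exists_pos (Set.mem_univ y)
      exact ⟨i, by simpa [S] using hi⟩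
    have hS2 : S.card ≤ n + 1 := by
      rw [← Set.ncard_coe_finset]
      refine (Set.ncard_le_ncard (fun i hi => ?_) (Set.toFinite _)).trans (hVn y)
      exact hpV i y (by simpa [S] using hi)
    have := hS1.card_pos
    refine ⟨⟨S.card - 1, by omega⟩, S, by simp; omega, fun i hi => ?_⟩
    have hi' : 0 < p i y := by simpa [S] using hi
    refine ⟨hi', fun l hl => lt_of_le_of_lt ?_ hi'⟩
    simpa [S] using hl

/-! ### Free actions of compact groups: open sets with small return times -/

section FreeAction

variable {G X : Type*} [Group G] [TopologicalSpace G] [CompactSpace G]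
  [MetricSpace X] [MulAction G X] [ContinuousSMul G X]

variable (G X) in
theorem properSMul_of_compact [CompactSpace X] : ProperSMul G X where
  isProperMap_smul_pair := Continuous.isProperMap (by fun_prop)

-- Properness of the action makes the quotient Hausdorff, and it is compact. Normality is what the
-- partition of unity in Ostrand's decomposition needs.
variable (G X) in
theorem t4Space_orbit [CompactSpace X] : T4Space (MulAction.orbitRel.Quotient G X) := by
  have := properSMul_of_compact G X
  have : T2Space (MulAction.orbitRel.Quotient G X) := t2Space_quotient_mulAction_of_properSMul
  have : CompactSpace (MulAction.orbitRel.Quotient G X) := Quotient.compactSpace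
  infer_instance

/-- A point with trivial stabilizer has a neighbourhood whose return times are close to `1`. -/
theorem exists_open_return_subset {x : X} (hx : ∀ g : G, g • x = x → g = 1) {W : Set G}
    (hW : W ∈ 𝓝 (1 : G)) :
    ∃ B : Set X, IsOpen B ∧ x ∈ B ∧ ∀ (s : G) (y : X), y ∈ B → s • y ∈ B → s ∈ W := by
  have hK : IsCompact (interior W)ᶜ := isOpen_interior.isClosed_compl.isCompact
  -- Freeness separates `s • x` from `x` for each `s` outside the interior of `W`; continuity makes
  -- this uniform near `(s, x)`, and compactness leaves finitely many conditions.
  have key : ∀ s ∈ (interior W)ᶜ, ∃ N ∈ 𝓝 s, ∃ B ∈ 𝓝 x, ∀ t ∈ N, ∀ y ∈ B, t • y ∉ B := by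
    intro s hs
    have hne : s • x ≠ x := fun he => by
      rw [hx s he] at hs
      exact hs (mem_interior_iff_mem_nhds.mpr hW)
    obtain ⟨u, v, hu, hv, hsu, hxv, huv⟩ := t2_separation hne
    have hc : (fun q : G × X => q.1 • q.2) ⁻¹' u ∈ 𝓝 (s, x) :=
      (continuous_smul.tendsto (s, x)).eventually (hu.mem_nhds hsu)
    obtain ⟨N, hN, B, hB, hNB⟩ := mem_nhds_prod_iff.mp hc
    refine ⟨N, hN, B ∩ v, inter_mem hB (hv.mem_nhds hxv), fun t ht y hy hty => ?_⟩
    exact Set.disjoint_left.mp huv (hNB (Set.mk_mem_prod ht hy.1)) hty.2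
  choose! N hN B hB hNB using key
  obtain ⟨t, htK, ht⟩ := hK.elim_nhds_subcover N hN
  have hmem : (⋂ s ∈ t, B s) ∈ 𝓝 x := (biInter_finset_mem t).mpr fun s hs => hB s (htK s hs)
  refine ⟨interior (⋂ s ∈ t, B s), isOpen_interior, mem_interior_iff_mem_nhds.mpr hmem,
    fun s y hy hsy => ?_⟩
  by_contra hs
  obtain ⟨r, hr, hsr⟩ := Set.mem_iUnion₂.mp (ht (fun h => hs (interior_subset h)))
  exact hNB r (htK r hr) s hsr y (Set.mem_iInter₂.mp (interior_subset hy) r hr)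
    (Set.mem_iInter₂.mp (interior_subset hsy) r hr)

/-- Open sets `O₀, …, O_d` with small return times whose saturations cover `X`, where `d` bounds
the dimension of the orbit space. -/
theorem exists_open_slices [CompactSpace X] (hfree : ∀ (g : G) (x : X), g • x = x → g = 1) {d : ℕ}
    (hd : CoveringDimLE (MulAction.orbitRel.Quotient G X) d) {W : Set G} (hW : W ∈ 𝓝 (1 : G)) :
    ∃ O : Fin (d + 1) → Set X, (∀ j, IsOpen (O j)) ∧
      (∀ j (s : G) (y : X), y ∈ O j → s • y ∈ O j → s ∈ W) ∧
      ∀ x : X, ∃ j, ∃ g : G, g • x ∈ O j := by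
  have := t4Space_orbit G X
  have : CompactSpace (MulAction.orbitRel.Quotient G X) := Quotient.compactSpace
  let π : X → MulAction.orbitRel.Quotient G X := Quotient.mk''
  have hπ : Continuous π := continuous_quotient_mk'
  have hπo : IsOpenMap π := isOpenMap_quotient_mk'_mul
  choose B hBo hxB hBW using fun x : X => exists_open_return_subset (fun g => hfree g x) hW
  obtain ⟨t, ht⟩ := isCompact_univ.elim_finite_subcover (fun x => π '' B x)
    (fun x => hπo _ (hBo x)) (fun y _ => by
      obtain ⟨x, rfl⟩ := Quotient.mk''_surjective y
      exact Set.mem_iUnion.mpr ⟨x, x, hxB x, rfl⟩)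
  let e : Fin t.card ≃ t := t.equivFin.symm
  obtain ⟨m, V, hVo, hVU, hVd, hVc⟩ := hd.exists_disjoint_families (fun i => π '' B (e i))
    (fun i => hπo _ (hBo _)) (Set.eq_univ_of_univ_subset fun y hy => by
      obtain ⟨x, hx, hy⟩ := Set.mem_iUnion₂.mp (ht hy)
      exact Set.mem_iUnion.mpr ⟨e.symm ⟨x, hx⟩, by simpa using hy⟩)
  choose c hc using hVU
  -- Each `V j S` is lifted inside a single chosen neighbourhood `B`. As `y` and `s • y` have the
  -- same image, disjointness within a colour puts them in the same piece, hence in the same `B`.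
  refine ⟨fun j => ⋃ (S) (h : (V j S).Nonempty), π ⁻¹' V j S ∩ B (e (c j S h)), fun j => ?_, ?_,
    fun x => ?_⟩
  · exact isOpen_iUnion fun S => isOpen_iUnion fun h => ((hVo j S).preimage hπ).inter (hBo _)
  · intro j s y hy hsy
    obtain ⟨S, hS, hy1, hy2⟩ := Set.mem_iUnion₂.mp hy
    obtain ⟨T, hT, hsy1, hsy2⟩ := Set.mem_iUnion₂.mp hsy
    have hπs : π (s • y) = π y := Quotient.sound' (MulAction.mem_orbit y s)
    rw [Set.mem_preimage, hπs] at hsy1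
    obtain rfl := hVd j S T _ hy1 hsy1
    exact hBW _ s y hy2 hsy2
  · obtain ⟨j, S, hS⟩ := hVc (π x)
    obtain ⟨z, hz, hzx⟩ := hc j S ⟨_, hS⟩ hS
    obtain ⟨g, hg⟩ : z ∈ MulAction.orbit G x := Quotient.exact' hzx
    refine ⟨j, g, Set.mem_iUnion₂.mpr ⟨S, ⟨_, hS⟩, ?_, ?_⟩⟩
    · rw [Set.mem_preimage]
      have : π (g • x) = π x := Quotient.sound' (MulAction.mem_orbit x g)
      rwa [this]
    · change g • x = z at hg
      rwa [hg]

end FreeAction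

/-! ### Haar averages along orbits -/

section Averaging

open MeasureTheory

theorem exists_continuous_pos_iff_mem {X : Type*} [PseudoMetricSpace X] {O : Set X}
    (hO : IsOpen O) : ∃ f : C(X, ℝ), (∀ x, 0 ≤ f x) ∧ ∀ x, 0 < f x ↔ x ∈ O := by
  -- `Metric.infDist` to the empty set is `0`, so `O = X` is treated apart.
  rcases (Oᶜ).eq_empty_or_nonempty with h | h
  · refine ⟨1, fun x => zero_le_one, fun x => ⟨fun _ => ?_, fun _ => zero_lt_one⟩⟩
    exact Set.compl_empty_iff.mp h ▸ Set.mem_univ x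
  · refine ⟨⟨fun x => Metric.infDist x Oᶜ, Metric.continuous_infDist_pt _⟩,
      fun x => Metric.infDist_nonneg, fun x => ?_⟩
    refine (hO.isClosed_compl.notMem_iff_infDist_pos h).symm.trans ?_
    simp

theorem integrable_of_continuous {G E : Type*} [TopologicalSpace G] [CompactSpace G]
    [MeasurableSpace G] [BorelSpace G] (μ : Measure G) [IsFiniteMeasureOnCompacts μ]
    [NormedAddCommGroup E] {F : G → E} (hF : Continuous F) : Integrable F μ :=
  hF.integrable_of_hasCompactSupport (HasCompactSupport.of_compactSpace F)

theorem continuous_integral_of_continuous {G X E : Type*} [TopologicalSpace G] [CompactSpace G]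
    [SecondCountableTopology G] [MeasurableSpace G] [BorelSpace G] (μ : Measure G)
    [IsLocallyFiniteMeasure μ] [TopologicalSpace X] [FirstCountableTopology X]
    [LocallyCompactSpace X] [NormedAddCommGroup E] [NormedSpace ℝ E] {F : X → G → E}
    (hF : Continuous F.uncurry) : Continuous fun x => ∫ g, F x g ∂μ := by
  simpa using continuous_parametric_integral_of_continuous (μ := μ) hF isCompact_univ

theorem integral_inv_smul_smul {G X E : Type*} [Group G] [TopologicalSpace G]
    [IsTopologicalGroup G] [MeasurableSpace G] [BorelSpace G] (μ : Measure G)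
    [μ.IsMulLeftInvariant] [MulAction G X] [NormedAddCommGroup E] [NormedSpace ℝ E]
    (F : X → E) (s : G) (x : X) :
    ∫ g, F (g⁻¹ • s • x) ∂μ = ∫ g, F (g⁻¹ • x) ∂μ := by
  rw [← integral_mul_left_eq_self (fun g => F (g⁻¹ • x)) s⁻¹]
  simp [mul_smul]

variable {G X : Type*} [Group G] [TopologicalSpace G] [IsTopologicalGroup G] [CompactSpace G]
  [SecondCountableTopology G] [MeasurableSpace G] [BorelSpace G]
  [MetricSpace X] [CompactSpace X] [MulAction G X] [ContinuousSMul G X]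
  (μ : Measure G) [μ.IsHaarMeasure]

/-- Kernels with small return times whose orbit averages add up to `1`. -/
theorem exists_kernels (hfree : ∀ (g : G) (x : X), g • x = x → g = 1) {d : ℕ}
    (hd : CoveringDimLE (MulAction.orbitRel.Quotient G X) d) {W : Set G} (hW : W ∈ 𝓝 (1 : G)) :
    ∃ K : Fin (d + 1) → C(X, ℝ), (∀ j x, 0 ≤ K j x) ∧
      (∀ j (s : G) (y : X), 0 < K j y → 0 < K j (s • y) → s ∈ W) ∧
      ∀ x, ∑ j, ∫ g, K j (g⁻¹ • x) ∂μ = 1 := by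
  obtain ⟨O, hOo, hOW, hOc⟩ := exists_open_slices hfree hd hW
  choose f hf0 hfO using fun j => exists_continuous_pos_iff_mem (hOo j)
  have hfc : ∀ j, Continuous fun x => ∫ g, f j (g⁻¹ • x) ∂μ := fun j =>
    continuous_integral_of_continuous μ (F := fun x g => f j (g⁻¹ • x))
      ((f j).continuous.comp (f := fun q : X × G => q.2⁻¹ • q.1) (by fun_prop))
  have hnn : ∀ j x, 0 ≤ ∫ g, f j (g⁻¹ • x) ∂μ := fun j x => integral_nonneg fun g => hf0 j _
  let D : X → ℝ := fun x => ∑ j, ∫ g, f j (g⁻¹ • x) ∂μ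
  have hDc : Continuous D := continuous_finsetSum _ fun j _ => hfc j
  have hDpos : ∀ x, 0 < D x := fun x => by
    obtain ⟨j, g, hg⟩ := hOc x
    refine Finset.sum_pos' (fun j _ => hnn j x) ⟨j, Finset.mem_univ j, ?_⟩
    -- Haar measure charges open sets, and the integrand at `g⁻¹` is `f j (g • x) ≠ 0`.
    refine Continuous.integral_pos_of_hasCompactSupport_nonneg_nonzero (x := g⁻¹)
      ((f j).continuous.comp (by fun_prop)) (HasCompactSupport.of_compactSpace _)
      (fun g => hf0 j _) ?_
    simpa using ((hfO j _).mpr hg).ne'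
  -- Invariance lets `D` leave the orbit integrals, so dividing by it normalises their sum to `1`.
  have hDinv : ∀ (s : G) x, D (s • x) = D x := fun s x =>
    Finset.sum_congr rfl fun j _ => integral_inv_smul_smul μ (f j) s x
  refine ⟨fun j => ⟨fun x => f j x / D x, (f j).continuous.div hDc fun x => (hDpos x).ne'⟩,
    fun j x => div_nonneg (hf0 j x) (hDpos x).le, fun j s y hy hsy => ?_, fun x => ?_⟩
  · exact hOW j s y ((hfO j y).mp ((div_pos_iff_of_pos_right (hDpos y)).mp hy))
      ((hfO j _).mp ((div_pos_iff_of_pos_right (hDpos _)).mp hsy))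
  · simp only [ContinuousMap.coe_mk, hDinv, integral_div, ← Finset.sum_div]
    exact div_self (hDpos x).ne'

/-- Integration of `f` against the translates of a kernel `K`. -/
noncomputable def kernelMap (K : C(X, ℝ)) : C(G, ℂ) →ₗ[ℂ] C(X, ℂ) where
  toFun f := ⟨fun x => ∫ g, f g * (K (g⁻¹ • x) : ℂ) ∂μ,
    continuous_integral_of_continuous μ (F := fun x g => f g * (K (g⁻¹ • x) : ℂ))
      (by unfold Function.uncurry; fun_prop)⟩
  map_add' f₁ f₂ := by
    ext x
    simp only [ContinuousMap.add_apply, ContinuousMap.coe_mk, add_mul]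
    exact integral_add (integrable_of_continuous μ (by fun_prop))
      (integrable_of_continuous μ (by fun_prop))
  map_smul' c f := by
    ext x
    simp only [ContinuousMap.smul_apply, ContinuousMap.coe_mk, smul_eq_mul, mul_assoc,
      RingHom.id_apply]
    exact integral_const_mul _ _

theorem kernelMap_apply (K : C(X, ℝ)) (f : C(G, ℂ)) (x : X) :
    kernelMap μ K f x = ∫ g, f g * (K (g⁻¹ • x) : ℂ) ∂μ := rfl

theorem kernelMap_one_apply (K : C(X, ℝ)) (x : X) :
    kernelMap μ K 1 x = ((∫ g, K (g⁻¹ • x) ∂μ : ℝ) : ℂ) := by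
  simp only [kernelMap_apply, ContinuousMap.one_apply, one_mul]
  exact integral_ofReal

/-- Left invariance of Haar measure makes equivariance exact, with no error to control later. -/
theorem kernelMap_leftTranslate (K : C(X, ℝ)) (s : G) (f : C(G, ℂ)) :
    kernelMap μ K (leftTranslate s f) = translateEquiv G X s (kernelMap μ K f) := by
  ext x
  change ∫ g, f (s⁻¹ * g) * (K (g⁻¹ • x) : ℂ) ∂μ = ∫ g, f g * (K (g⁻¹ • s⁻¹ • x) : ℂ) ∂μ
  rw [← integral_mul_left_eq_self (fun g => f g * (K (g⁻¹ • s⁻¹ • x) : ℂ)) s⁻¹]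
  simp [mul_smul]

end Averaging

/-! ### Localized equivariant maps -/

section Localized

variable {G X : Type*} [Group G] [TopologicalSpace G] [CompactSpace G]
  [TopologicalSpace X]

/-- `ψ(f)(x)` is the integral of `f` against a positive measure of mass at most `1` concentrated on
a translate of `W`, up to the oscillation of `f`. -/
def IsLocalized (W : Set G) (ψ : C(G, ℂ) →ₗ[ℂ] C(X, ℂ)) : Prop :=
  ∀ x, ∃ (m : ℝ) (g₀ : G), 0 ≤ m ∧ m ≤ 1 ∧ ψ 1 x = m ∧ (∀ f, ‖ψ f x‖ ≤ ‖f‖ * m) ∧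
    ∀ (f : C(G, ℂ)) (ε : ℝ), (∀ g g' : G, g⁻¹ * g' ∈ W → ‖f g' - f g‖ ≤ ε) →
      ‖ψ f x - f g₀ * m‖ ≤ ε * m

end Localized

section Towers

open MeasureTheory

variable {G X : Type*} [Group G] [TopologicalSpace G] [IsTopologicalGroup G] [CompactSpace G]
  [SecondCountableTopology G] [MetricSpace X] [CompactSpace X] [MulAction G X]
  [ContinuousSMul G X]

theorem isLocalized_kernelMap [MeasurableSpace G] [BorelSpace G] (μ : Measure G)
    [μ.IsHaarMeasure] {W : Set G} {K : C(X, ℝ)} (hK : ∀ x, 0 ≤ K x)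
    (hKW : ∀ (s : G) (y : X), 0 < K y → 0 < K (s • y) → s ∈ W)
    (hK1 : ∀ x, ∫ g, K (g⁻¹ • x) ∂μ ≤ 1) : IsLocalized W (kernelMap (G := G) μ K) := by
  intro x
  -- Any `g₀` at which the kernel is positive serves: two such points differ by a return time. If
  -- there is none, the mass is `0` and `1` will do.
  obtain ⟨g₀, hg₀⟩ : ∃ g₀ : G, ∀ g : G, 0 < K (g⁻¹ • x) → g₀⁻¹ * g ∈ W := by
    by_cases h : ∃ g₀ : G, 0 < K (g₀⁻¹ • x)
    · obtain ⟨g₀, h₀⟩ := h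
      exact ⟨g₀, fun g hg => hKW _ _ hg (by simpa [mul_smul] using h₀)⟩
    · exact ⟨1, fun g hg => (h ⟨g, hg⟩).elim⟩
  have hint : Integrable (fun g : G => K (g⁻¹ • x)) μ :=
    integrable_of_continuous μ (by fun_prop)
  have hnorm : ∀ g : G, ‖(K (g⁻¹ • x) : ℂ)‖ = K (g⁻¹ • x) := fun g => by
    rw [Complex.norm_real, Real.norm_of_nonneg (hK _)]
  refine ⟨∫ g, K (g⁻¹ • x) ∂μ, g₀, integral_nonneg fun g => hK _, hK1 x,
    kernelMap_one_apply μ K x, fun f => ?_, fun f ε hf => ?_⟩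
  · rw [← integral_const_mul]
    refine norm_integral_le_of_norm_le (hint.const_mul _) (ae_of_all _ fun g => ?_)
    rw [norm_mul, hnorm]
    exact mul_le_mul_of_nonneg_right (f.norm_coe_le_norm g) (hK _)
  · have : kernelMap μ K f x - f g₀ * ((∫ g, K (g⁻¹ • x) ∂μ : ℝ) : ℂ)
        = ∫ g, (f g - f g₀) * (K (g⁻¹ • x) : ℂ) ∂μ := by
      have hr : ((∫ g, K (g⁻¹ • x) ∂μ : ℝ) : ℂ) = ∫ g, (K (g⁻¹ • x) : ℂ) ∂μ :=
        integral_ofReal.symm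
      simp only [sub_mul]
      rw [kernelMap_apply, hr, ← integral_const_mul, integral_sub]
      · exact integrable_of_continuous μ (by fun_prop)
      · exact integrable_of_continuous μ (by fun_prop)
    rw [this, ← integral_const_mul]
    refine norm_integral_le_of_norm_le (hint.const_mul _) (ae_of_all _ fun g => ?_)
    rw [norm_mul, hnorm]
    rcases (hK (g⁻¹ • x)).eq_or_lt with h | h
    · simp [← h]
    · exact mul_le_mul_of_nonneg_right (hf _ _ (hg₀ g h)) (hK _)

/-- Exactly equivariant, `W`-localized maps `C(G) → C(X)` whose values at `1` add up to `1`. -/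
theorem exists_localized_towers (hfree : ∀ (g : G) (x : X), g • x = x → g = 1) {d : ℕ}
    (hd : CoveringDimLE (MulAction.orbitRel.Quotient G X) d) {W : Set G} (hW : W ∈ 𝓝 (1 : G)) :
    ∃ ψ : Fin (d + 1) → C(G, ℂ) →ₗ[ℂ] C(X, ℂ), (∀ j, IsLocalized W (ψ j)) ∧
      (∀ j s f, ψ j (leftTranslate s f) = translateEquiv G X s (ψ j f)) ∧ ∑ j, ψ j 1 = 1 := by
  borelize G
  let μ : Measure G := Measure.haar
  obtain ⟨K, hK, hKW, hK1⟩ := exists_kernels μ hfree hd hW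
  refine ⟨fun j => kernelMap μ (K j), fun j => ?_, fun j s f => kernelMap_leftTranslate μ _ s f, ?_⟩
  · refine isLocalized_kernelMap μ (hK j) (hKW j) fun x => ?_
    rw [← hK1 x]
    exact Finset.single_le_sum (f := fun j => ∫ g, K j (g⁻¹ • x) ∂μ)
      (fun j _ => integral_nonneg fun g => hK j _) (Finset.mem_univ j)
  · ext x
    simp only [ContinuousMap.sum_apply, kernelMap_one_apply, ContinuousMap.one_apply]
    rw [← Complex.ofReal_sum, hK1, Complex.ofReal_one]

end Towers

/-! ### Complete positivity from a factorisation -/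

theorem exists_eq_star_mul_self_of_nonneg {B : Type*} [NonUnitalCStarAlgebra B] [PartialOrder B]
    [StarOrderedRing B] {M : B} (hM : 0 ≤ M) : ∃ N, M = star N * N :=
  CStarAlgebra.nonneg_iff_eq_star_mul_self.mp hM

/-- A linear map `φ` with `φ(a* b) = θ(a)* θ(b)` is completely positive. -/
theorem cstarMatrix_map_nonneg {A B : Type*} [NonUnitalCStarAlgebra A] [NonUnitalCStarAlgebra B]
    [PartialOrder A] [StarOrderedRing A] [PartialOrder B] [StarOrderedRing B]
    (φ : A →ₗ[ℂ] B) (θ : A → B) (h : ∀ a b, φ (star a * b) = star (θ a) * θ b) (k : ℕ)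
    (M : CStarMatrix (Fin k) (Fin k) A) (hM : 0 ≤ M) : 0 ≤ M.map φ := by
  obtain ⟨N, rfl⟩ := exists_eq_star_mul_self_of_nonneg hM
  -- Only additivity of `φ` is used here; `θ` need not be linear.
  have : (star N * N).map φ = star (N.map θ) * N.map θ := by
    ext i j
    simp [CStarMatrix.mul_apply, CStarMatrix.star_apply, h]
  rw [this]
  exact star_mul_self_nonneg _

/-! ### Central sequences of a commutative algebra -/

section CommutativeCentralSequences

variable {X : Type*} [TopologicalSpace X] [CompactSpace X]

theorem mem_relCommutant_of_commutative (a : SeqAlgebra C(X, ℂ)) : a ∈ relCommutant C(X, ℂ) := by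
  rw [mem_relCommutant]
  intro b
  obtain ⟨a, rfl⟩ := mkL_surjective _ a
  change eta _ (constSeq b) * eta _ a = eta _ a * eta _ (constSeq b)
  rw [← map_mul, ← map_mul]
  congr 1
  ext n : 2
  exact mul_comm _ _

variable (X) in
/-- Every bounded sequence in a commutative algebra is central; this is its class in `F(C(X))`. -/
noncomputable def centralClass : BoundedSeq C(X, ℂ) →⋆ₙₐ[ℂ] CentralSeqAlgebra C(X, ℂ) :=
  (kappa C(X, ℂ)).comp
    (NonUnitalStarAlgHom.codRestrict (eta C(X, ℂ)) _ fun _ => mem_relCommutant_of_commutative _)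

theorem centralClass_surjective : Function.Surjective (centralClass X) := by
  intro x
  obtain ⟨⟨a, ha⟩, rfl⟩ := mkL_surjective _ x
  obtain ⟨b, rfl⟩ := mkL_surjective _ a
  exact ⟨b, rfl⟩

theorem norm_centralClass_le (a : BoundedSeq C(X, ℂ)) : ‖centralClass X a‖ ≤ ‖a‖ :=
  NonUnitalStarAlgHom.norm_apply_le _ a

theorem centralClass_eq_zero {a : BoundedSeq C(X, ℂ)} (h : Tendsto (fun n => a n) atTop (𝓝 0)) :
    centralClass X a = 0 := by
  have h0 : eta C(X, ℂ) a = 0 := by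
    rw [← map_zero (eta C(X, ℂ))]
    refine (mkL_eq_iff _).mpr ?_
    rw [sub_zero]
    exact h
  have : NonUnitalStarAlgHom.codRestrict (eta C(X, ℂ)) (relCommutant C(X, ℂ))
      (fun _ => mem_relCommutant_of_commutative _) a = 0 := Subtype.ext h0
  exact (congrArg (kappa C(X, ℂ)) this).trans (map_zero _)

theorem centralClass_seqMap (θ : C(X, ℂ) ≃⋆ₐ[ℂ] C(X, ℂ)) (a : BoundedSeq C(X, ℂ)) :
    centralClass X (seqMap θ a) = centralSeqMap θ (centralClass X a) := rfl

theorem centralClass_mem {G : Type*} [Group G] [TopologicalSpace G] {α : CStarAction G C(X, ℂ)}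
    {a : BoundedSeq C(X, ℂ)} (ha : a ∈ α.contSeq) : centralClass X a ∈ α.contCentralSeqAlgebra :=
  ⟨⟨eta _ a, mem_relCommutant_of_commutative _⟩, ⟨a, ha, rfl⟩, rfl⟩

theorem centralClass_one_mul (x : CentralSeqAlgebra C(X, ℂ)) :
    centralClass X (constSeq 1) * x = x ∧ x * centralClass X (constSeq 1) = x := by
  obtain ⟨a, rfl⟩ := centralClass_surjective x
  rw [← map_mul, ← map_mul]
  constructor <;> congr 1 <;> ext n : 2
  · exact one_mul _
  · exact mul_one _

end CommutativeCentralSequences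

/-! ### Uniform continuity on a compact group -/

section UniformContinuity

theorem exists_nhds_one_norm_sub_le {G : Type*} [Group G] [TopologicalSpace G]
    [IsTopologicalGroup G] [CompactSpace G] (f : C(G, ℂ)) {ε : ℝ} (hε : 0 < ε) :
    ∃ W ∈ 𝓝 (1 : G), ∀ g g' : G, g⁻¹ * g' ∈ W → ‖f g' - f g‖ ≤ ε := by
  have h : ∀ᶠ w in 𝓝 (1 : G), ∀ g ∈ (Set.univ : Set G), ‖f (g * w) - f g‖ < ε := by
    refine isCompact_univ.eventually_forall_of_forall_eventually fun g _ => ?_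
    have hc : Continuous fun q : G × G => ‖f (q.2 * q.1) - f q.2‖ := by fun_prop
    have := hc.tendsto (1, g)
    exact this.eventually (gt_mem_nhds (by simpa using hε))
  exact ⟨_, h, fun g g' hg => by simpa using (hg g (Set.mem_univ g)).le⟩

end UniformContinuity

/-! ### From localized maps to Rokhlin towers -/

section Assembly

variable {G X : Type*} [Group G] [TopologicalSpace G] [CompactSpace G]
  [TopologicalSpace X] [CompactSpace X]

theorem IsLocalized.norm_apply_le {W : Set G} {ψ : C(G, ℂ) →ₗ[ℂ] C(X, ℂ)} (h : IsLocalized W ψ)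
    (f : C(G, ℂ)) : ‖ψ f‖ ≤ ‖f‖ := by
  refine (ContinuousMap.norm_le _ (norm_nonneg f)).mpr fun x => ?_
  obtain ⟨m, -, -, hm1, -, hn, -⟩ := h x
  exact (hn f).trans (mul_le_of_le_one_right (norm_nonneg f) hm1)

/-- Both maps are sampled at the same `g₀`, where one of `f₁`, `f₂` vanishes; that factor is at most
`ε` and the other is bounded by its norm. -/
theorem IsLocalized.norm_mul_le {W : Set G} {ψ : C(G, ℂ) →ₗ[ℂ] C(X, ℂ)} (h : IsLocalized W ψ)
    {f₁ f₂ : C(G, ℂ)} (h12 : f₁ * f₂ = 0) {ε : ℝ} (hε : 0 ≤ ε)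
    (h1 : ∀ g g' : G, g⁻¹ * g' ∈ W → ‖f₁ g' - f₁ g‖ ≤ ε)
    (h2 : ∀ g g' : G, g⁻¹ * g' ∈ W → ‖f₂ g' - f₂ g‖ ≤ ε) (x : X) :
    ‖ψ f₁ x‖ * ‖ψ f₂ x‖ ≤ ε * (‖f₁‖ + ‖f₂‖) := by
  have hb : ∀ f, ‖ψ f x‖ ≤ ‖f‖ := fun f =>
    ((ψ f).norm_coe_le_norm x).trans (h.norm_apply_le f)
  obtain ⟨m, g₀, hm0, hm1, -, -, hloc⟩ := h x
  have key : ∀ f : C(G, ℂ), (∀ g g' : G, g⁻¹ * g' ∈ W → ‖f g' - f g‖ ≤ ε) → f g₀ = 0 →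
      ‖ψ f x‖ ≤ ε := fun f hf h0 => by
    have := hloc f ε hf
    rw [h0, zero_mul, sub_zero] at this
    exact this.trans (mul_le_of_le_one_right hε hm1)
  have h0 : f₁ g₀ * f₂ g₀ = 0 := congrArg (fun f : C(G, ℂ) => f g₀) h12
  rcases mul_eq_zero.mp h0 with h0 | h0
  · calc ‖ψ f₁ x‖ * ‖ψ f₂ x‖ ≤ ε * ‖f₂‖ := by
          gcongr
          exacts [key f₁ h1 h0, hb f₂]
      _ ≤ ε * (‖f₁‖ + ‖f₂‖) := by gcongr; linarith [norm_nonneg f₁]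
  · calc ‖ψ f₁ x‖ * ‖ψ f₂ x‖ ≤ ‖f₁‖ * ε := by
          gcongr
          exacts [hb f₁, key f₂ h2 h0]
      _ = ε * ‖f₁‖ := mul_comm _ _
      _ ≤ ε * (‖f₁‖ + ‖f₂‖) := by gcongr; linarith [norm_nonneg f₂]

/-- Approximate inverse square root of `ψ(1)`. -/
noncomputable def invSqrt (u : C(X, ℂ)) {δ : ℝ} (hδ : 0 < δ) : C(X, ℂ) :=
  -- The truncation at `0` keeps this continuous for every `u`; it is inactive for `u = ψ 1`, whose
  -- values lie in `[0, 1]`.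
  ⟨fun x => (((Real.sqrt (max (u x).re 0 + δ))⁻¹ : ℝ) : ℂ), by
    refine Complex.continuous_ofReal.comp (Continuous.inv₀ (by fun_prop) fun x => ?_)
    exact (Real.sqrt_pos.mpr (by positivity)).ne'⟩

theorem IsLocalized.norm_mul_invSqrt_le {W : Set G} {ψ : C(G, ℂ) →ₗ[ℂ] C(X, ℂ)}
    (h : IsLocalized W ψ) (f : C(G, ℂ)) {δ : ℝ} (hδ : 0 < δ) :
    ‖ψ f * invSqrt (ψ 1) hδ‖ ≤ ‖f‖ := by
  refine (ContinuousMap.norm_le _ (norm_nonneg f)).mpr fun x => ?_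
  obtain ⟨m, -, hm0, hm1, hm, hn, -⟩ := h x
  have hs : 0 < Real.sqrt (m + δ) := Real.sqrt_pos.mpr (by positivity)
  -- Here `m² ≤ m ≤ m + δ`, because `0 ≤ m ≤ 1`.
  have hms : m ≤ Real.sqrt (m + δ) := Real.le_sqrt_of_sq_le (by nlinarith)
  have : invSqrt (ψ 1) hδ x = (((Real.sqrt (m + δ))⁻¹ : ℝ) : ℂ) := by
    simp [invSqrt, hm, max_eq_left hm0]
  rw [ContinuousMap.mul_apply, norm_mul, this, Complex.norm_real, Real.norm_of_nonneg
    (inv_nonneg.mpr hs.le), ← div_eq_mul_inv, div_le_iff₀ hs]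
  exact (hn f).trans (by gcongr)

/-- With `p = f₁ g₀` and `q = f₂ g₀`, the two terms are close to `p̄ q m` and `p̄ q m² / (m + δ)`,
which differ by `p̄ q m δ / (m + δ)`, at most `‖f₁‖ ‖f₂‖ δ` in modulus. -/
theorem IsLocalized.norm_star_mul_sub_le {W : Set G} {ψ : C(G, ℂ) →ₗ[ℂ] C(X, ℂ)}
    (h : IsLocalized W ψ) {f₁ f₂ : C(G, ℂ)} {ε : ℝ} (hε : 0 ≤ ε)
    (h1 : ∀ g g' : G, g⁻¹ * g' ∈ W → ‖f₁ g' - f₁ g‖ ≤ ε)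
    (h2 : ∀ g g' : G, g⁻¹ * g' ∈ W → ‖f₂ g' - f₂ g‖ ≤ ε)
    (h3 : ∀ g g' : G, g⁻¹ * g' ∈ W → ‖(star f₁ * f₂) g' - (star f₁ * f₂) g‖ ≤ ε)
    {δ : ℝ} (hδ : 0 < δ) :
    ‖ψ (star f₁ * f₂) - star (ψ f₁ * invSqrt (ψ 1) hδ) * (ψ f₂ * invSqrt (ψ 1) hδ)‖
      ≤ ε * (‖f₁‖ + ‖f₂‖ + 1) + ‖f₁‖ * ‖f₂‖ * δ := by
  refine (ContinuousMap.norm_le _ (by positivity)).mpr fun x => ?_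
  obtain ⟨m, g₀, hm0, hm1, hm, hn, hloc⟩ := h x
  have hmδ : 0 < m + δ := by positivity
  have hr : invSqrt (ψ 1) hδ x = (((Real.sqrt (m + δ))⁻¹ : ℝ) : ℂ) := by
    simp [invSqrt, hm, max_eq_left hm0]
  set r : ℝ := (Real.sqrt (m + δ))⁻¹ with hrdef
  have hr2 : r * r = (m + δ)⁻¹ := by
    rw [hrdef, ← mul_inv, Real.mul_self_sqrt hmδ.le]
  have hrr : (r : ℂ) * r = ((m + δ)⁻¹ : ℝ) := by rw [← Complex.ofReal_mul, hr2]
  have e1 := hloc f₁ ε h1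
  have e2 := hloc f₂ ε h2
  have e3 := hloc _ ε h3
  have hb2 := hn f₂
  have n1 := f₁.norm_coe_le_norm g₀
  have n2 := f₂.norm_coe_le_norm g₀
  set a := ψ f₁ x
  set b := ψ f₂ x
  set c := ψ (star f₁ * f₂) x
  set p := f₁ g₀
  set q := f₂ g₀
  have hpq : (star f₁ * f₂) g₀ = star p * q := rfl
  rw [hpq] at e3
  have hval : (ψ (star f₁ * f₂) - star (ψ f₁ * invSqrt (ψ 1) hδ) * (ψ f₂ * invSqrt (ψ 1) hδ)) x
      = (c - star p * q * m) + star p * q * ((m * (δ * (m + δ)⁻¹) : ℝ) : ℂ)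
        - (star (a - p * m) * b + star p * m * (b - q * m)) * ((m + δ)⁻¹ : ℝ) := by
    have hm' : ((m + δ : ℝ) : ℂ) ≠ 0 := Complex.ofReal_ne_zero.mpr hmδ.ne'
    have h1 : (ψ (star f₁ * f₂) - star (ψ f₁ * invSqrt (ψ 1) hδ) *
        (ψ f₂ * invSqrt (ψ 1) hδ)) x = c - star (a * invSqrt (ψ 1) hδ x) *
        (b * invSqrt (ψ 1) hδ x) := rfl
    rw [h1, hr]
    have h2 : star (a * (r : ℂ)) * (b * r) = star a * b * ((m + δ)⁻¹ : ℝ) := by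
      rw [← hrr, star_mul', Complex.star_def, Complex.conj_ofReal]
      ring
    rw [h2]
    have h3 : star (a - p * (m : ℂ)) = star a - star p * m := by
      rw [star_sub, star_mul', Complex.star_def, Complex.conj_ofReal]
    rw [h3]
    push_cast at hm' ⊢
    field_simp
    ring
  have hD : δ * (m + δ)⁻¹ ≤ 1 := by
    rw [← div_eq_mul_inv, div_le_one hmδ]; linarith
  have hM : m * (m + δ)⁻¹ ≤ 1 := by
    rw [← div_eq_mul_inv, div_le_one hmδ]; linarith
  have hMD : m * (δ * (m + δ)⁻¹) ≤ δ := by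
    calc m * (δ * (m + δ)⁻¹) = δ * (m * (m + δ)⁻¹) := by ring
      _ ≤ δ := mul_le_of_le_one_right hδ.le hM
  have t2 : ‖star p * q * ((m * (δ * (m + δ)⁻¹) : ℝ) : ℂ)‖ ≤ ‖f₁‖ * ‖f₂‖ * δ := by
    rw [norm_mul, norm_mul, norm_star, Complex.norm_real, Real.norm_of_nonneg (by positivity)]
    gcongr
  -- The localization error and the values themselves are both of order `m`. One factor of `m²`
  -- absorbs `(m + δ)⁻¹`, so no `1/δ` appears and `δ` may tend to `0` independently of `ε`.
  have t3 : ‖star (a - p * m) * b + star p * m * (b - q * m)‖ ≤ ε * (‖f₁‖ + ‖f₂‖) * m * m := by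
    refine (norm_add_le _ _).trans ?_
    rw [norm_mul, norm_mul, norm_mul, norm_star, norm_star, Complex.norm_real,
      Real.norm_of_nonneg hm0]
    calc _ ≤ ε * m * (‖f₂‖ * m) + ‖f₁‖ * m * (ε * m) := by gcongr
      _ = _ := by ring
  have t4 : ‖(star (a - p * m) * b + star p * m * (b - q * m)) * (((m + δ)⁻¹ : ℝ) : ℂ)‖
      ≤ ε * (‖f₁‖ + ‖f₂‖) := by
    rw [norm_mul, Complex.norm_real, Real.norm_of_nonneg (by positivity)]
    calc _ ≤ ε * (‖f₁‖ + ‖f₂‖) * m * m * (m + δ)⁻¹ := by gcongr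
      _ = ε * (‖f₁‖ + ‖f₂‖) * (m * (m * (m + δ)⁻¹)) := by ring
      _ ≤ ε * (‖f₁‖ + ‖f₂‖) :=
        mul_le_of_le_one_right (by positivity) (mul_le_one₀ hm1 (by positivity) hM)
  rw [hval]
  calc _ ≤ ε * m + ‖f₁‖ * ‖f₂‖ * δ + ε * (‖f₁‖ + ‖f₂‖) :=
        (norm_sub_le _ _).trans (add_le_add ((norm_add_le _ _).trans (add_le_add e3 t2)) t4)
    _ ≤ ε * 1 + ‖f₁‖ * ‖f₂‖ * δ + ε * (‖f₁‖ + ‖f₂‖) := by gcongr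
    _ = _ := by ring

variable [IsTopologicalGroup G] {ψ : ℕ → C(G, ℂ) →ₗ[ℂ] C(X, ℂ)} {W : ℕ → Set G}

/-- The sequence `(u n)` of contractive maps, as a map into bounded sequences. -/
noncomputable def toBoundedSeq {E : Type*} [Norm E] (u : ℕ → E → C(X, ℂ)) (hu : ∀ n f, ‖u n f‖ ≤ ‖f‖) (f : E) :
    BoundedSeq C(X, ℂ) :=
  ⟨fun n => u n f, memℓp_infty ⟨‖f‖, by rintro _ ⟨n, rfl⟩; exact hu n f⟩⟩

/-- The linear map into `F(C(X))` given by a sequence of contractive linear maps. -/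
noncomputable def seqLinearMap (ψ : ℕ → C(G, ℂ) →ₗ[ℂ] C(X, ℂ)) (hψ : ∀ n f, ‖ψ n f‖ ≤ ‖f‖) :
    C(G, ℂ) →L[ℂ] BoundedSeq C(X, ℂ) :=
  LinearMap.mkContinuous
    { toFun := toBoundedSeq (fun n => ψ n) hψ
      map_add' := fun f₁ f₂ => by ext n : 2; exact map_add (ψ n) f₁ f₂
      map_smul' := fun c f => by ext n : 2; exact map_smul (ψ n) c f } 1
    (fun f => by
      rw [one_mul]
      exact lp.norm_le_of_forall_le (norm_nonneg f) fun n => hψ n f)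

theorem tendsto_zero_of_eventually_norm_le {E : Type*} [NormedAddCommGroup E] {u : ℕ → E}
    {C D : ℝ} (hC : 0 ≤ C)
    (h : ∀ ε > 0, ∀ᶠ n : ℕ in atTop, ‖u n‖ ≤ ε * C + D * (1 / ((n : ℝ) + 1))) :
    Tendsto u atTop (𝓝 0) := by
  rw [tendsto_zero_iff_norm_tendsto_zero]
  refine (tendsto_order.mpr ⟨fun a ha => Eventually.of_forall fun n => ha.trans_le (norm_nonneg _),
    fun a ha => ?_⟩)
  have hD : Tendsto (fun n : ℕ => D * (1 / ((n : ℝ) + 1))) atTop (𝓝 0) := by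
    simpa using tendsto_one_div_add_atTop_nhds_zero_nat.const_mul D
  filter_upwards [h (a / (2 * (C + 1))) (by positivity), hD.eventually (gt_mem_nhds (half_pos ha))]
    with n h1 h2
  have : a / (2 * (C + 1)) * C ≤ a / 2 := by
    rw [div_mul_eq_mul_div, div_le_div_iff₀ (by positivity) two_pos]
    nlinarith
  linarith

theorem eventually_norm_sub_le (hW : (𝓝 (1 : G)).HasAntitoneBasis W) (f : C(G, ℂ)) {ε : ℝ}
    (hε : 0 < ε) : ∀ᶠ n in atTop, ∀ g g' : G, g⁻¹ * g' ∈ W n → ‖f g' - f g‖ ≤ ε := by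
  obtain ⟨V, hV, hVf⟩ := exists_nhds_one_norm_sub_le f hε
  exact (hW.eventually_subset hV).mono fun n hn g g' hg => hVf g g' (hn hg)

set_option synthInstance.maxHeartbeats 200000 in
/-- A sequence of localized maps gives a completely positive map into `F(C(X))`. -/
noncomputable def towerMap (hW : (𝓝 (1 : G)).HasAntitoneBasis W) (hψ : ∀ n, IsLocalized (W n) (ψ n)) :
    C(G, ℂ) →CP CentralSeqAlgebra C(X, ℂ) where
  toFun f := centralClass X (seqLinearMap ψ (fun n => (hψ n).norm_apply_le) f)
  map_add' f₁ f₂ := by rw [map_add, map_add]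
  map_smul' c f := (congrArg (centralClass X) ((seqLinearMap ψ _).map_smul c f)).trans
    ((centralClass X).map_smul' c _)
  map_cstarMatrix_nonneg' := by
    -- The regularisation at stage `n` is `δ = 1/(n + 1)`.
    refine cstarMatrix_map_nonneg _ (fun f => centralClass X (toBoundedSeq
      (fun n f => ψ n f * invSqrt (ψ n 1) (Nat.one_div_pos_of_nat (α := ℝ) (n := n)))
      (fun n f => (hψ n).norm_mul_invSqrt_le f _) f)) fun f₁ f₂ => ?_
    rw [← map_star, ← map_mul, ← sub_eq_zero]
    refine (map_sub (centralClass X) _ _).symm.trans (centralClass_eq_zero ?_)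
    refine tendsto_zero_of_eventually_norm_le (C := ‖f₁‖ + ‖f₂‖ + 1) (D := ‖f₁‖ * ‖f₂‖)
      (by positivity) fun ε hε => ?_
    filter_upwards [eventually_norm_sub_le hW f₁ hε, eventually_norm_sub_le hW f₂ hε,
      eventually_norm_sub_le hW (star f₁ * f₂) hε] with n h1 h2 h3
    exact (hψ n).norm_star_mul_sub_le hε.le h1 h2 h3 _

theorem towerMap_apply (hW : (𝓝 (1 : G)).HasAntitoneBasis W) (hψ : ∀ n, IsLocalized (W n) (ψ n))
    (f : C(G, ℂ)) :
    towerMap hW hψ f = centralClass X (seqLinearMap ψ (fun n => (hψ n).norm_apply_le) f) := rfl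

theorem centralClass_mul_seqLinearMap_eq_zero (hW : (𝓝 (1 : G)).HasAntitoneBasis W)
    (hψ : ∀ n, IsLocalized (W n) (ψ n)) {f₁ f₂ : C(G, ℂ)} (h : f₁ * f₂ = 0)
    (a : BoundedSeq C(X, ℂ)) (ha : ∀ n x, ‖a n x‖ ≤ ‖ψ n f₁ x‖ * ‖ψ n f₂ x‖) :
    centralClass X a = 0 := by
  refine centralClass_eq_zero (tendsto_zero_of_eventually_norm_le (C := ‖f₁‖ + ‖f₂‖) (D := 0)
    (by positivity) fun ε hε => ?_)
  filter_upwards [eventually_norm_sub_le hW f₁ hε, eventually_norm_sub_le hW f₂ hε] with n h1 h2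
  rw [zero_mul, add_zero]
  exact (ContinuousMap.norm_le _ (by positivity)).mpr fun x =>
    (ha n x).trans ((hψ n).norm_mul_le h hε.le h1 h2 x)

theorem isRokhlinTower_towerMap [MulAction G X] [ContinuousSMul G X]
    (hW : (𝓝 (1 : G)).HasAntitoneBasis W) (hψ : ∀ n, IsLocalized (W n) (ψ n))
    (heq : ∀ n s f, ψ n (leftTranslate s f) = translateEquiv G X s (ψ n f)) :
    IsRokhlinTower (inducedAction G X) (towerMap hW hψ) := by
  have hseq : ∀ s f, seqLinearMap ψ (fun n => (hψ n).norm_apply_le) (leftTranslate s f) =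
      seqMap ((inducedAction G X).toHom s)
        (seqLinearMap ψ (fun n => (hψ n).norm_apply_le) f) := fun s f => by
    ext n : 2
    exact heq n s f
  refine ⟨fun f => ?_, fun s f => ?_, fun f => ?_, fun f₁ f₂ h => ?_⟩
  · refine centralClass_mem ?_
    change Continuous fun g => seqMap _ _
    simp only [← hseq]
    -- Left translation is the action induced by `G` on itself, so its orbit maps are continuous;
    -- equivariance and boundedness carry this over to the sequence.
    exact (ContinuousLinearMap.continuous _).comp ((inducedAction G G).continuous' f)
  · rw [towerMap_apply, hseq]
    rfl
  · refine (norm_centralClass_le _).trans ?_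
    exact lp.norm_le_of_forall_le (norm_nonneg f) fun n => (hψ n).norm_apply_le f
  · simp only [towerMap_apply, Orthogonal]
    simp only [← map_star (centralClass X), ← map_mul (centralClass X)]
    have h21 : f₂ * f₁ = 0 := h.2.1
    refine ⟨?_, ?_, ?_, ?_⟩
    · exact centralClass_mul_seqLinearMap_eq_zero hW hψ h.1 _ fun n x => (norm_mul _ _).le
    · exact centralClass_mul_seqLinearMap_eq_zero hW hψ h21 _ fun n x => (norm_mul _ _).le
    · exact centralClass_mul_seqLinearMap_eq_zero hW hψ h.1 _ fun n x =>
        (norm_mul _ _).le.trans_eq (congrArg (· * _) (norm_star _))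
    · exact centralClass_mul_seqLinearMap_eq_zero hW hψ h21 _ fun n x =>
        (norm_mul _ _).le.trans_eq (congrArg (· * _) (norm_star _))

end Assembly

/-! ### Conclusion -/

theorem hasRokhlinTowers_of_coveringDimLE {G X : Type*} [Group G] [TopologicalSpace G]
    [IsTopologicalGroup G] [CompactSpace G] [SecondCountableTopology G] [MetricSpace X]
    [CompactSpace X] [MulAction G X] [ContinuousSMul G X]
    (hfree : ∀ (g : G) (x : X), g • x = x → g = 1) {d : ℕ}
    (hd : CoveringDimLE (MulAction.orbitRel.Quotient G X) d) :
    HasRokhlinTowers (inducedAction G X) d := by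
  obtain ⟨W, hW⟩ := (𝓝 (1 : G)).exists_antitone_basis
  choose ψ hloc heq hsum using fun n => exists_localized_towers (X := X) hfree hd (hW.mem n)
  refine ⟨fun j => towerMap hW fun n => hloc n j,
    fun j => isRokhlinTower_towerMap hW _ fun n => heq n j, fun x => ?_⟩
  -- The maps sum to `1` at every stage `n`, so the sum is the class of a constant sequence.
  have : ∑ j, towerMap hW (fun n => hloc n j) 1 = centralClass X (constSeq 1) := by
    simp only [towerMap_apply]
    rw [← map_sum]
    congr 1
    ext n : 2
    rw [lp.coeFn_sum, Finset.sum_apply]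
    exact hsum n
  rw [this]
  exact centralClass_one_mul x

end CStarRokhlin

theorem mainTheorem5 (G X : Type*)
    [Group G] [TopologicalSpace G] [IsTopologicalGroup G] [CompactSpace G]
    [SecondCountableTopology G]
    [MetricSpace X] [CompactSpace X] [MulAction G X] [ContinuousSMul G X]
    (hfree : ∀ (g : G) (x : X), g • x = x → g = 1) :
    CStarRokhlin.rokhlinDim (CStarRokhlin.inducedAction G X) ≤
      CStarRokhlin.coveringDim (MulAction.orbitRel.Quotient G X) :=
  le_iInf₂ fun _ hd => iInf₂_le _ (CStarRokhlin.hasRokhlinTowers_of_coveringDimLE hfree hd)
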